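/- Let $Y$ be a non-zero real Banach space with the Daugavet property, i.e. $\|I+T\|=1+\|T\|$ for every bounded rank-one operator $T\colon Y\to Y$. A slice of a bounded set $A\subset Y$ is a non-empty set of the form $S(A,y^*,\varepsilon)=\{x\in A: y^*(x)>\sup_{a\in A} y^*(a)-\varepsilon\}$ with $y^*\in Y^*\setminus\{0\}$ and $\varepsilon>0$. A bounded set $A$ is called SCD (slicely countably determined) if there is a sequence $(S_n)_{n\in\mathbb N}$ of slices of $A$ such that $A\subset\overline{\operatorname{conv}}(B)$ for every $B\subset Y$ that intersects all the $S_n$. A set $C$ is called symmetric if $-C=C$. **Theorem.** There are convex, closed, bounded, symmetric SCD sets $C_1,C_2\subset Y$ whose intersection $C_1\cap C_2$ is not SCD. If, in addition, $Y$ is separable, then such sets $C_1,C_2$ can be chosen to be bodies, i.e. to have non-empty interior. -/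

import Mathlib

section SlicelyCountablyDetermined

variable {X : Type*} [NormedAddCommGroup X] [NormedSpace ℝ X]

/-- The set `S(A, f, ε) = {x ∈ A : f x > sup f(A) - ε}`. -/
noncomputable def sliceSet (A : Set X) (f : X →L[ℝ] ℝ) (ε : ℝ) : Set X :=
  {x | x ∈ A ∧ sSup (f '' A) - ε < f x}

/-- `S` is a slice of the (bounded) set `A`: a non-empty set of the form `S(A, f, ε)` with
`f` a non-zero bounded real functional and `ε > 0`. -/
def IsSlice (A S : Set X) : Prop :=
  S.Nonempty ∧ ∃ f : X →L[ℝ] ℝ, f ≠ 0 ∧ ∃ ε : ℝ, 0 < ε ∧ S = sliceSet A f ε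

/-- A sequence of non-empty subsets `U n` of `A` is determining for `A` if `A` lies in the closed
convex hull of every `B ⊆ X` that intersects all the `U n`. -/
def IsDetermining (A : Set X) (U : ℕ → Set X) : Prop :=
  (∀ n, (U n).Nonempty ∧ U n ⊆ A) ∧
    ∀ B : Set X, (∀ n, (B ∩ U n).Nonempty) → A ⊆ closure (convexHull ℝ B)

/-- Slicely countably determined (SCD) sets: bounded sets having a determining sequence of
slices. -/
def IsSCD (A : Set X) : Prop :=
  Bornology.IsBounded A ∧ ∃ U : ℕ → Set X, (∀ n, IsSlice A (U n)) ∧ IsDetermining A U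

/-- Convex closed bounded sets that are symmetric with respect to zero. -/
structure IsSymmetricConvexClosedBounded (C : Set X) : Prop where
  convex : Convex ℝ C
  isClosed : IsClosed C
  isBounded : Bornology.IsBounded C
  neg_mem : ∀ x ∈ C, -x ∈ C

variable (X) in
/-- The Daugavet property: every bounded operator `T` of rank one satisfies the Daugavet equation
`‖I + T‖ = 1 + ‖T‖`. -/
def HasDaugavetProperty : Prop :=
  ∀ T : X →L[ℝ] X, Module.finrank ℝ (LinearMap.range (T : X →ₗ[ℝ] X)) = 1 →
    ‖ContinuousLinearMap.id ℝ X + T‖ = 1 + ‖T‖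

end SlicelyCountablyDetermined

/-! Suppose first that the space `X` is separable. Splitting off a two-dimensional subspace `G`
identifies `X` with `Q × ℝ × ℝ`, where `Q = X ⧸ G`. The intersection will be the box, the unit ball
of the `ℓ_∞`-sum.

The box is not SCD. By the Daugavet property, every non-empty cut of the ball of `X` contains a
vector almost `ℓ₁`-orthogonal to a prescribed finite-dimensional subspace
(`exists_mem_cut_norm_add_smul`). Given countably many cuts of the box, points of them can therefore
be chosen one after another so that a fixed vector keeps a positive distance from their whole span
(`escapesCuts_unitBox`).

The box is an intersection of SCD sets. Let `y n` be dense in the sphere of `Q`, each term recurring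
infinitely often, and let `u n → 0` be distinct positive heights. The tips `(±(1 - u n ^ 2) y n, ±(1
+ u n), ±1)` are countably many and strongly exposed: the points `(1 - u ^ 2, 1 + u)` lie on a
parabola, so a tangent functional singles out one height even where directions repeat. Hence their
closed convex hull is SCD (`isSCD_spikeBody`). It contains the box because `u n → 0`, and leaves it
only in the first scalar direction. Exchanging the scalars gives a second body, and the two meet
exactly in the box.

In general the construction is carried out in a closed separable subspace that keeps the hull form
of the Daugavet property, and transported by Hahn–Banach. Interior points are lost on the way. -/

section DaugavetSCD

open Set Filter Topology

/-! ### Almost `ℓ₁`-orthogonal vectors in cuts of the ball -/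

section DaugavetGeometry

variable {X : Type*} [NormedAddCommGroup X] [NormedSpace ℝ X]

/-- The points of norm almost at most `‖z‖` at which the triangle inequality with `x` is almost an
equality. -/
def almostAdditiveSet (x z : X) (ε : ℝ) : Set X :=
  {y | ‖y‖ < ‖z‖ + ε ∧ ‖x‖ + ‖z‖ - ε < ‖x + y‖}

variable (X) in
/-- A reformulation of the Daugavet property by closed convex hulls, which passes to suitable
separable subspaces. -/
def HasDaugavetHullProperty : Prop :=
  ∀ x z : X, ∀ ε : ℝ, 0 < ε → z ∈ closure (convexHull ℝ (almostAdditiveSet x z ε))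

theorem exists_norm_eq_one_smul_eq {E : Type*} [NormedAddCommGroup E] [NormedSpace ℝ E]
    [Nontrivial E] (x : E) : ∃ e : E, ‖e‖ = 1 ∧ x = ‖x‖ • e := by
  rcases eq_or_ne x 0 with rfl | hx
  · obtain ⟨e, he⟩ := exists_norm_eq E (zero_le_one)
    exact ⟨e, he, by simp⟩
  · have : ‖x‖ ≠ 0 := norm_ne_zero_iff.2 hx
    exact ⟨‖x‖⁻¹ • x, by rw [norm_smul, norm_inv, norm_norm, inv_mul_cancel₀ this],
      by rw [smul_smul, mul_inv_cancel₀ this, one_smul]⟩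

/-- `max a b • (x + u)` differs from `a • x + b • u` only by `|a - b|` times one of the two vectors,
so the defect `δ` is merely scaled by `max a b`. -/
theorem le_norm_smul_add_smul {x u : X} {δ a b : ℝ} (hx : ‖x‖ ≤ 1) (hu : ‖u‖ ≤ 1)
    (h : 2 - δ ≤ ‖x + u‖) (ha : 0 ≤ a) (hb : 0 ≤ b) :
    a + b - max a b * δ ≤ ‖a • x + b • u‖ := by
  rcases le_total a b with hab | hab
  · rw [max_eq_right hab]
    have h1 : b • (x + u) = (a • x + b • u) + (b - a) • x := by module
    have h2 : b * ‖x + u‖ ≤ ‖a • x + b • u‖ + (b - a) * ‖x‖ := by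
      have := norm_add_le (a • x + b • u) ((b - a) • x)
      rwa [← h1, norm_smul, norm_smul, Real.norm_of_nonneg hb,
        Real.norm_of_nonneg (sub_nonneg.2 hab)] at this
    have h3 := mul_le_mul_of_nonneg_left h hb
    have h4 := mul_le_mul_of_nonneg_left hx (sub_nonneg.2 hab)
    linarith
  · rw [max_eq_left hab]
    have h1 : a • (x + u) = (a • x + b • u) + (a - b) • u := by module
    have h2 : a * ‖x + u‖ ≤ ‖a • x + b • u‖ + (a - b) * ‖u‖ := by
      have := norm_add_le (a • x + b • u) ((a - b) • u)
      rwa [← h1, norm_smul, norm_smul, Real.norm_of_nonneg ha,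
        Real.norm_of_nonneg (sub_nonneg.2 hab)] at this
    have h3 := mul_le_mul_of_nonneg_left h ha
    have h4 := mul_le_mul_of_nonneg_left hu (sub_nonneg.2 hab)
    linarith

/-- The operator `f ⊗ x` has norm one, so `‖I + f ⊗ x‖ = 2`. A vector `u` of the ball almost
attaining this norm, with its sign chosen so that `f u ≥ 0`, must have `f u` near 1, and then `u + f
u • x` is near `u + x`. -/
theorem HasDaugavetProperty.exists_mem_slice (hX : HasDaugavetProperty X) {f : X →L[ℝ] ℝ}
    (hf : ‖f‖ = 1) {x : X} (hx : ‖x‖ = 1) {δ : ℝ} (hδ : 0 < δ) :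
    ∃ u : X, ‖u‖ ≤ 1 ∧ 1 - δ < f u ∧ 2 - δ < ‖x + u‖ := by
  have hx0 : x ≠ 0 := by rintro rfl; simp at hx
  have hf0 : f ≠ 0 := by rintro rfl; simp at hf
  have hrange : LinearMap.range ((f.smulRight x : X →L[ℝ] X) : X →ₗ[ℝ] X) = ℝ ∙ x := by
    ext y
    simp only [LinearMap.mem_range, ContinuousLinearMap.coe_coe,
      ContinuousLinearMap.smulRight_apply, Submodule.mem_span_singleton]
    obtain ⟨v, hv⟩ : ∃ v, f v ≠ 0 := by
      by_contra! h
      exact hf0 (ContinuousLinearMap.ext h)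
    refine ⟨fun ⟨a, ha⟩ => ⟨f a, ha⟩, fun ⟨c, hc⟩ => ⟨(c / f v) • v, ?_⟩⟩
    rw [map_smul, smul_eq_mul, div_mul_cancel₀ _ hv, hc]
  have hnorm := hX (f.smulRight x) (by rw [hrange]; exact finrank_span_singleton hx0)
  rw [ContinuousLinearMap.norm_smulRight_apply, hf, hx] at hnorm
  obtain ⟨u, hu, hu'⟩ := ContinuousLinearMap.exists_lt_apply_of_lt_opNorm
    (ContinuousLinearMap.id ℝ X + f.smulRight x) (r := 2 - δ / 2) (by rw [hnorm]; linarith)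
  wlog hfu : 0 ≤ f u generalizing u
  · refine this (-u) (by rwa [norm_neg]) ?_ (by rw [map_neg]; linarith)
    rwa [map_neg, norm_neg]
  have hu1 : 2 - δ / 2 < ‖u + f u • x‖ := by simpa using hu'
  have h1 : ‖u + f u • x‖ ≤ ‖u‖ + f u := by
    have := norm_add_le u (f u • x)
    rwa [norm_smul, hx, mul_one, Real.norm_of_nonneg hfu] at this
  have hle : f u ≤ 1 := by
    have := (le_abs_self _).trans (f.le_opNorm u)
    rw [hf, one_mul] at this
    linarith
  have h2 : ‖u + f u • x‖ ≤ ‖x + u‖ + (1 - f u) := by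
    have h3 : u + f u • x = (x + u) + (-(1 - f u)) • x := by module
    have := norm_add_le (x + u) ((-(1 - f u)) • x)
    rwa [← h3, norm_smul, hx, mul_one, norm_neg, Real.norm_of_nonneg (by linarith)] at this
  exact ⟨u, hu.le, by linarith, by linarith⟩

theorem HasDaugavetProperty.hasDaugavetHullProperty (hX : HasDaugavetProperty X) :
    HasDaugavetHullProperty X := by
  intro x z ε hε
  rcases eq_or_ne z 0 with rfl | hz
  · exact subset_closure (subset_convexHull ℝ _ (by simp [almostAdditiveSet, hε]))
  have : Nontrivial X := ⟨z, 0, hz⟩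
  have : Nontrivial (X →L[ℝ] ℝ) := by
    obtain ⟨g, hg, -⟩ := exists_dual_vector ℝ z (norm_ne_zero_iff.2 hz)
    exact ⟨g, 0, by rintro rfl; simp at hg⟩
  by_contra hcon
  obtain ⟨f, s, hfs, hsz⟩ := geometric_hahn_banach_closed_point
    (convex_convexHull ℝ (almostAdditiveSet x z ε)).closure isClosed_closure hcon
  obtain ⟨g, hg, hfg⟩ := exists_norm_eq_one_smul_eq f
  obtain ⟨e, he, hxe⟩ := exists_norm_eq_one_smul_eq x
  set m := ‖x‖ + ‖z‖ with hm
  have hzpos : 0 < ‖z‖ := norm_pos_iff.2 hz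
  have hmpos : 0 < m := by positivity
  obtain ⟨δ, hδ, hδ1, hδ2⟩ : ∃ δ : ℝ, 0 < δ ∧ m * δ < ε ∧ ‖f‖ * ‖z‖ * δ < f z - s := by
    have hc : 0 < f z - s := sub_pos.2 hsz
    have hd : 0 < ‖f‖ * ‖z‖ + 1 := by positivity
    refine ⟨min (ε / (2 * m)) ((f z - s) / (2 * (‖f‖ * ‖z‖ + 1))), by positivity, ?_, ?_⟩
    · calc _ ≤ m * (ε / (2 * m)) := by gcongr; exact min_le_left _ _
        _ = ε / 2 := by field_simp
        _ < ε := by linarith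
    · calc _ ≤ ‖f‖ * ‖z‖ * ((f z - s) / (2 * (‖f‖ * ‖z‖ + 1))) := by
            gcongr; exact min_le_right _ _
        _ ≤ (‖f‖ * ‖z‖ + 1) * ((f z - s) / (2 * (‖f‖ * ‖z‖ + 1))) := by gcongr; linarith
        _ = (f z - s) / 2 := by field_simp
        _ < f z - s := by linarith
  obtain ⟨u, hu, hgu, hxu⟩ := hX.exists_mem_slice hg he hδ
  have hmem : ‖z‖ • u ∈ almostAdditiveSet x z ε := by
    constructor
    · rw [norm_smul, norm_norm]
      have := mul_le_mul_of_nonneg_left hu hzpos.le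
      linarith
    · have h1 := le_norm_smul_add_smul he.le hu hxu.le (norm_nonneg x) hzpos.le
      rw [← hxe] at h1
      have h2 : max ‖x‖ ‖z‖ * δ ≤ m * δ := by
        gcongr
        exact max_le (by linarith) (by linarith [norm_nonneg x])
      linarith
  have h1 := hfs _ (subset_closure (subset_convexHull ℝ _ hmem))
  have h2 : f (‖z‖ • u) = ‖f‖ * ‖z‖ * g u := by
    conv_lhs => rw [hfg]
    simp only [_root_.smul_apply, map_smul, smul_eq_mul]
    ring
  have h3 : ‖f‖ * ‖z‖ * (1 - δ) ≤ ‖f‖ * ‖z‖ * g u := by gcongr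
  have h4 : f z ≤ ‖f‖ * ‖z‖ := (le_abs_self _).trans (f.le_opNorm z)
  linarith

/-- Inside a non-empty cut of the unit ball there is a smaller one, on which the norm is almost
additive with respect to a given unit vector. -/
theorem HasDaugavetHullProperty.exists_cut (hX : HasDaugavetHullProperty X) {φ : X →L[ℝ] ℝ} {c : ℝ}
    (hφ : ∃ y : X, ‖y‖ ≤ 1 ∧ c < φ y) {x : X} (hx : ‖x‖ = 1) {ε : ℝ} (hε : 0 < ε) :
    ∃ (ψ : X →L[ℝ] ℝ) (d : ℝ), (∃ y : X, ‖y‖ ≤ 1 ∧ d < ψ y) ∧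
      ∀ y : X, ‖y‖ ≤ 1 → d < ψ y → c < φ y ∧ 2 - ε ≤ ‖x + y‖ := by
  obtain ⟨z, hz, hcz⟩ := hφ
  have : Nontrivial X := ⟨x, 0, by rintro rfl; simp at hx⟩
  obtain ⟨e, he, hce⟩ : ∃ e : X, ‖e‖ = 1 ∧ c < φ e := by
    obtain ⟨e, he, hze⟩ := exists_norm_eq_one_smul_eq z
    have h1 : c < |φ e| := by
      refine hcz.trans_le ((le_abs_self _).trans ?_)
      rw [hze, map_smul, smul_eq_mul, abs_mul, abs_norm]
      exact mul_le_of_le_one_left (abs_nonneg _) hz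
    rcases lt_abs.1 h1 with h | h
    · exact ⟨e, he, h⟩
    · exact ⟨-e, by rwa [norm_neg], by rwa [map_neg]⟩
  set γ := φ e - c with hγ
  have hγ0 : 0 < γ := sub_pos.2 hce
  set η := γ / 8 with hη
  -- The new cut uses `φ + K • ψ`, with `ψ` norming `x + v`. The weight `K` is so large that `ψ` is
  -- nearly 1 on the cut, whatever `φ` does. Then `δ` is taken small relative to `K`, so that the
  -- term in `ψ` cannot spoil the bound for `φ`.
  set K := 2 * (η + 2 * ‖φ‖) / ε with hK
  have hK0 : 0 < K := by positivity
  have hKε : K * ε = 2 * (η + 2 * ‖φ‖) := by rw [hK]; field_simp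
  obtain ⟨δ, hδ0, hδ1, hδ2, hδ3⟩ : ∃ δ : ℝ, 0 < δ ∧ 8 * δ ≤ ε ∧ 16 * (K * δ) ≤ γ ∧
      4 * (‖φ‖ * δ) ≤ γ := by
    refine ⟨min (ε / 8) (γ / (16 * K + 4 * ‖φ‖)), by positivity, ?_, ?_, ?_⟩
    · linarith [min_le_left (ε / 8) (γ / (16 * K + 4 * ‖φ‖))]
    all_goals
      have h1 := (le_div_iff₀ (by positivity)).1
        (min_le_right (ε / 8) (γ / (16 * K + 4 * ‖φ‖)))
      have h2 : 0 ≤ min (ε / 8) (γ / (16 * K + 4 * ‖φ‖)) := by positivity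
      have h3 := mul_nonneg h2 hK0.le
      have h4 := mul_nonneg h2 (norm_nonneg φ)
      linarith
  obtain ⟨y, ⟨hy1, hy2⟩, hφy⟩ : ∃ y ∈ almostAdditiveSet x e δ, c + γ / 2 < φ y := by
    by_contra! h
    have h1 : closure (convexHull ℝ (almostAdditiveSet x e δ)) ⊆ {y | φ y ≤ c + γ / 2} :=
      closure_minimal (convexHull_min h (convex_halfSpace_le φ.isLinear _))
        (isClosed_le φ.continuous continuous_const)
    have h2 : φ e ≤ c + γ / 2 := h1 (hX x e δ hδ0)
    linarith
  rw [he] at hy1 hy2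
  rw [hx] at hy2
  set v := (1 + δ)⁻¹ • y with hv
  have hv1 : ‖v‖ ≤ 1 := by
    rw [hv, norm_smul, norm_inv, Real.norm_of_nonneg (by linarith)]
    rw [inv_mul_le_iff₀ (by linarith)]
    linarith
  have hyv : y = v + δ • v := by
    rw [show v + δ • v = (1 + δ) • v by module, hv, smul_smul, mul_inv_cancel₀ (by linarith),
      one_smul]
  have hδv : ‖δ • v‖ ≤ δ := by
    rw [norm_smul, Real.norm_of_nonneg hδ0.le]
    exact mul_le_of_le_one_right hδ0.le hv1
  have hφv : c + γ / 4 ≤ φ v := by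
    have h1 : φ y = φ v + φ (δ • v) := by rw [← map_add, ← hyv]
    have h2 : φ (δ • v) ≤ ‖φ‖ * δ :=
      (le_abs_self _).trans ((φ.le_opNorm _).trans (by gcongr))
    linarith
  have hxv : 2 - 2 * δ ≤ ‖x + v‖ := by
    have h1 : ‖x + y‖ ≤ ‖x + v‖ + ‖δ • v‖ := by
      have := norm_add_le (x + v) (δ • v)
      rwa [add_assoc, ← hyv] at this
    linarith
  obtain ⟨ψ, hψ, hψxv⟩ := exists_dual_vector'' ℝ (x + v)
  have hψle : ∀ w : X, ‖w‖ ≤ 1 → ψ w ≤ 1 := fun w hw =>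
    (le_abs_self _).trans ((ψ.le_opNorm w).trans (mul_le_one₀ hψ (norm_nonneg _) hw))
  have hφle : ∀ w : X, ‖w‖ ≤ 1 → |φ w| ≤ ‖φ‖ := fun w hw =>
    (φ.le_opNorm w).trans (mul_le_of_le_one_right (norm_nonneg _) hw)
  have hψxv' : ψ x + ψ v = ‖x + v‖ := by rw [← map_add, hψxv]; rfl
  have hψx := hψle x hx.le
  have hψv := hψle v hv1
  refine ⟨φ + K • ψ, (φ + K • ψ) v - η, ⟨v, hv1, by linarith [show 0 < η by positivity]⟩,
    fun w hw hwd => ?_⟩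
  have hwd' : φ v + K * ψ v - η < φ w + K * ψ w := by simpa using hwd
  have hψw := hψle w hw
  have h1 : K * (1 - 2 * δ) ≤ K * ψ v := mul_le_mul_of_nonneg_left (by linarith) hK0.le
  have h2 : K * ψ w ≤ K := mul_le_of_le_one_right hK0.le hψw
  refine ⟨by linarith, ?_⟩
  have h3 : K * (2 - ε) ≤ K * (ψ x + ψ w) := by
    have h4 := (abs_le.1 (hφle v hv1)).1
    have h5 := (abs_le.1 (hφle w hw)).2
    have h6 : K * (1 - 2 * δ) ≤ K * ψ x := mul_le_mul_of_nonneg_left (by linarith) hK0.le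
    have h7 : K * (8 * δ) ≤ K * ε := mul_le_mul_of_nonneg_left hδ1 hK0.le
    linarith
  have h4 : ψ x + ψ w ≤ ‖x + w‖ := by
    rw [← map_add]
    exact (le_abs_self _).trans ((ψ.le_opNorm _).trans
      (mul_le_of_le_one_left (norm_nonneg _) hψ))
  exact (le_of_mul_le_mul_left h3 hK0).trans h4

/-- The cuts are nested, so what is gained for one vector survives the treatment of the next. -/
theorem HasDaugavetHullProperty.exists_cut_finset (hX : HasDaugavetHullProperty X)
    {φ : X →L[ℝ] ℝ} {c : ℝ} (hφ : ∃ y : X, ‖y‖ ≤ 1 ∧ c < φ y) {ε : ℝ} (hε : 0 < ε)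
    {s : Set X} (hs : s.Finite) (hs1 : ∀ x ∈ s, ‖x‖ = 1) :
    ∃ (ψ : X →L[ℝ] ℝ) (d : ℝ), (∃ y : X, ‖y‖ ≤ 1 ∧ d < ψ y) ∧
      ∀ y : X, ‖y‖ ≤ 1 → d < ψ y → c < φ y ∧ ∀ x ∈ s, 2 - ε ≤ ‖x + y‖ := by
  induction s, hs using Set.Finite.induction_on with
  | empty => exact ⟨φ, c, hφ, fun y _ hy => ⟨hy, by simp⟩⟩
  | @insert a s _ _ ih =>
    obtain ⟨ψ, d, hne, h⟩ := ih fun x hx => hs1 x (mem_insert_of_mem _ hx)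
    obtain ⟨ψ', d', hne', h'⟩ := hX.exists_cut hne (hs1 a (mem_insert _ _)) hε
    refine ⟨ψ', d', hne', fun y hy hdy => ?_⟩
    obtain ⟨h1, h2⟩ := h' y hy hdy
    obtain ⟨h3, h4⟩ := h y hy h1
    refine ⟨h3, ?_⟩
    rintro x (rfl | hx)
    exacts [h2, h4 x hx]

/-- Every non-empty cut of the unit ball contains a vector which is almost `ℓ₁`-orthogonal to a
given finite-dimensional subspace. -/
theorem HasDaugavetHullProperty.exists_mem_cut_norm_add_smul (hX : HasDaugavetHullProperty X)
    {φ : X →L[ℝ] ℝ} {c : ℝ} (hφ : ∃ y : X, ‖y‖ ≤ 1 ∧ c < φ y) (F : Submodule ℝ X)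
    [FiniteDimensional ℝ F] {κ : ℝ} (hκ0 : 0 ≤ κ) (hκ : κ < 1) :
    ∃ b : X, ‖b‖ ≤ 1 ∧ c < φ b ∧ ∀ w ∈ F, ∀ t : ℝ, κ * ‖w‖ ≤ ‖w + t • b‖ := by
  -- Half of the admissible loss `1 - κ` goes to the finite net of the sphere of `F`, half to the
  -- cut.
  have hε : 0 < (1 - κ) / 2 := by linarith
  have : ProperSpace F := FiniteDimensional.proper ℝ F
  obtain ⟨N, hN, hNfin, hNcover⟩ := (isCompact_sphere (0 : F) 1).finite_cover_balls hε
  obtain ⟨ψ, d, ⟨b, hb, hdb⟩, h⟩ := hX.exists_cut_finset hφ hε (hNfin.image Subtype.val) (by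
    rintro _ ⟨x, hx, rfl⟩
    simpa using hN hx)
  obtain ⟨hcb, hsum⟩ := h b hb hdb
  have key : ∀ w ∈ F, w ≠ 0 → ∀ t : ℝ, 0 ≤ t → κ * ‖w‖ ≤ ‖w + t • b‖ := by
    intro w hw hw0 t ht
    have hw1 : ‖w‖ ≠ 0 := norm_ne_zero_iff.2 hw0
    set e : F := ‖w‖⁻¹ • ⟨w, hw⟩ with he
    have hwe : w = ‖w‖ • (e : X) := by
      simp [he, smul_smul, mul_inv_cancel₀ hw1]
    have hen : ‖(e : X)‖ = 1 := by
      simp [he, norm_smul, inv_mul_cancel₀ hw1]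
    obtain ⟨x, hx, hex⟩ := mem_iUnion₂.1
      (hNcover (show e ∈ Metric.sphere (0 : F) 1 by simpa using hen))
    have h1 : ‖(e : X) - x‖ < (1 - κ) / 2 := by
      simpa [dist_eq_norm] using hex
    have h2 : 2 - (1 - κ) ≤ ‖(e : X) + b‖ := by
      have h3 := hsum _ (mem_image_of_mem _ hx)
      have h4 := norm_sub_le ((e : X) + b) ((e : X) - x)
      rw [show (e : X) + b - ((e : X) - x) = x + b by abel] at h4
      linarith
    have h3 := le_norm_smul_add_smul hen.le hb h2 (norm_nonneg w) ht
    rw [← hwe] at h3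
    refine le_trans ?_ h3
    rcases le_total ‖w‖ t with hwt | hwt
    · rw [max_eq_right hwt]
      have := mul_le_mul_of_nonneg_left hwt hκ0
      have := norm_nonneg w
      linarith
    · rw [max_eq_left hwt]
      linarith
  refine ⟨b, hb, hcb, fun w hw t => ?_⟩
  rcases eq_or_ne w 0 with rfl | hw0
  · simp
  rcases le_total 0 t with ht | ht
  · exact key w hw hw0 t ht
  · have := key (-w) (F.neg_mem hw) (neg_ne_zero.2 hw0) (-t) (by linarith)
    rwa [norm_neg, neg_smul, ← neg_add, norm_neg] at this

/-- Otherwise some non-zero vector would be almost `ℓ₁`-orthogonal to the whole space, hence to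
itself. -/
theorem HasDaugavetHullProperty.not_finiteDimensional [Nontrivial X]
    (hX : HasDaugavetHullProperty X) : ¬ FiniteDimensional ℝ X := by
  intro hfin
  obtain ⟨z, hz⟩ := exists_norm_eq X zero_le_one
  obtain ⟨g, -, hgz⟩ := exists_dual_vector'' ℝ z
  obtain ⟨b, -, hgb, hb⟩ := hX.exists_mem_cut_norm_add_smul (φ := g) (c := 0)
    ⟨z, hz.le, by rw [hgz, hz]; simp⟩ ⊤ (κ := 1 / 2) (by norm_num) (by norm_num)
  have h1 := hb b trivial (-1)
  have h2 : b ≠ 0 := by rintro rfl; simp at hgb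
  have h3 := norm_pos_iff.2 h2
  rw [neg_one_smul, add_neg_cancel, norm_zero] at h1
  linarith

end DaugavetGeometry

/-! ### Reduction to a separable subspace -/

section SeparableSubspace

variable {X : Type*} [NormedAddCommGroup X] [NormedSpace ℝ X]

theorem exists_countable_subset_mem_closure_convexHull {s : Set X} {z : X}
    (hz : z ∈ closure (convexHull ℝ s)) :
    ∃ t ⊆ s, t.Countable ∧ z ∈ closure (convexHull ℝ t) := by
  obtain ⟨u, hu, hlim⟩ := mem_closure_iff_seq_limit.1 hz
  have h : ∀ n, ∃ t : Finset X, (t : Set X) ⊆ s ∧ u n ∈ convexHull ℝ (t : Set X) := by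
    intro n
    have := hu n
    rw [convexHull_eq_union_convexHull_finite_subsets] at this
    simpa using this
  choose t hts hut using h
  refine ⟨⋃ n, (t n : Set X), iUnion_subset hts,
    countable_iUnion fun n => (t n).countable_toSet, ?_⟩
  exact mem_closure_of_tendsto hlim (Eventually.of_forall fun n =>
    convexHull_mono (subset_iUnion (fun n => (t n : Set X)) n) (hut n))

theorem almostAdditiveSet_subset {E : Type*} [NormedAddCommGroup E] {x x' z z' : E}
    {δ ε : ℝ} (hx : ‖x - x'‖ ≤ δ) (hz : ‖z - z'‖ ≤ δ) (hδ : 0 ≤ δ) (h : 4 * δ ≤ ε) :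
    almostAdditiveSet x' z' δ ⊆ almostAdditiveSet x z ε := by
  rintro y ⟨h1, h2⟩
  have h3 := abs_le.1 ((abs_norm_sub_norm_le z z').trans hz)
  have h4 := abs_le.1 ((abs_norm_sub_norm_le x x').trans hx)
  have h5 := abs_le.1 ((abs_norm_sub_norm_le (x + y) (x' + y)).trans
    ((congrArg norm (add_sub_add_right_eq_sub x x' y)).trans_le hx))
  exact ⟨by linarith, by linarith⟩

theorem mem_closure_convexHull_almostAdditiveSet_of_mem_closure {S N : Set X}
    (h : ∀ x ∈ S, ∀ z ∈ S, ∀ ε > 0, z ∈ closure (convexHull ℝ (almostAdditiveSet x z ε ∩ N)))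
    {x z : X} (hx : x ∈ closure S) (hz : z ∈ closure S) {ε : ℝ} (hε : 0 < ε) :
    z ∈ closure (convexHull ℝ (almostAdditiveSet x z ε ∩ N)) := by
  rw [← closure_closure, Metric.mem_closure_iff]
  intro r hr
  obtain ⟨x', hx', hxx'⟩ := Metric.mem_closure_iff.1 hx (ε / 4) (by positivity)
  obtain ⟨z', hz', hzz'⟩ := Metric.mem_closure_iff.1 hz (min (ε / 4) r) (by positivity)
  rw [dist_eq_norm] at hxx'
  refine ⟨z', closure_mono (convexHull_mono (inter_subset_inter_left _ ?_))
    (h x' hx' z' hz' (ε / 4) (by positivity)), hzz'.trans_le (min_le_right _ _)⟩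
  refine almostAdditiveSet_subset hxx'.le ?_ (by positivity) (by linarith)
  rw [← dist_eq_norm]
  exact (hzz'.trans_le (min_le_left _ _)).le

/-- For a countable dense set of pairs `x`, `z` and for `ε = 1 / (n + 1)`, countably many witnesses
suffice. Adjoin them all; a perturbation argument covers the remaining pairs. -/
theorem HasDaugavetHullProperty.exists_le_isSeparable (hX : HasDaugavetHullProperty X)
    (M : Submodule ℝ X) (hM : TopologicalSpace.IsSeparable (M : Set X)) :
    ∃ M' : Submodule ℝ X, TopologicalSpace.IsSeparable (M' : Set X) ∧ M ≤ M' ∧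
      ∀ x ∈ M, ∀ z ∈ M, ∀ ε > 0,
        z ∈ closure (convexHull ℝ (almostAdditiveSet x z ε ∩ (M' : Set X))) := by
  obtain ⟨c, hcM, hc, hMc⟩ := hM.exists_countable_dense_subset
  choose T hTsub hTc hT using fun (x z : X) (n : ℕ) =>
    exists_countable_subset_mem_closure_convexHull
      (hX x z (1 / ((n : ℝ) + 1)) Nat.one_div_pos_of_nat)
  set A : Set X := ⋃ x ∈ c, ⋃ z ∈ c, ⋃ n, T x z n with hA
  have hAc : A.Countable :=
    hc.biUnion fun x _ => hc.biUnion fun z _ => countable_iUnion fun n => hTc x z n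
  refine ⟨Submodule.span ℝ (M ∪ A), (hM.union hAc.isSeparable).span,
    fun x hx => Submodule.subset_span (Or.inl hx), fun x hx z hz ε hε => ?_⟩
  refine mem_closure_convexHull_almostAdditiveSet_of_mem_closure (S := c) ?_ (hMc hx) (hMc hz) hε
  intro x hx z hz ε hε
  obtain ⟨n, hn⟩ := exists_nat_one_div_lt hε
  refine closure_mono (convexHull_mono ?_) (hT x z n)
  intro y hy
  refine ⟨?_, Submodule.subset_span (Or.inr ?_)⟩
  · have := hTsub x z n hy
    exact ⟨by linarith [this.1], by linarith [this.2]⟩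
  · exact mem_iUnion₂.2 ⟨x, hx, mem_iUnion₂.2 ⟨z, hz, mem_iUnion.2 ⟨n, hy⟩⟩⟩

/-- Iterating the enlargement countably often makes the union contain its own witnesses, and the
perturbation argument extends this to the closure. -/
theorem HasDaugavetHullProperty.exists_separable_submodule [Nontrivial X]
    (hX : HasDaugavetHullProperty X) :
    ∃ M : Submodule ℝ X, IsClosed (M : Set X) ∧ TopologicalSpace.IsSeparable (M : Set X) ∧
      Nontrivial M ∧ HasDaugavetHullProperty M := by
  obtain ⟨x₀, hx₀⟩ := exists_ne (0 : X)
  choose! next hsep hle hnext using hX.exists_le_isSeparable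
  set M : ℕ → Submodule ℝ X := fun n => next^[n] (ℝ ∙ x₀) with hMdef
  have hM0 : M 0 = ℝ ∙ x₀ := rfl
  have hMs : ∀ n, M (n + 1) = next (M n) := fun n => Function.iterate_succ_apply' _ _ _
  have hMsep : ∀ n, TopologicalSpace.IsSeparable (M n : Set X) := by
    intro n
    induction n with
    | zero => rw [hM0]; exact (countable_singleton x₀).isSeparable.span
    | succ n ih => rw [hMs]; exact hsep _ ih
  have hmono : Monotone M := monotone_nat_of_le_succ fun n => by
    rw [hMs]; exact hle _ (hMsep n)
  set S : Submodule ℝ X := ⨆ n, M n with hS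
  have hmemS : ∀ x, x ∈ S ↔ ∃ n, x ∈ M n := fun x =>
    Submodule.mem_iSup_of_directed M hmono.directed_le
  have hSeq : (S : Set X) = ⋃ n, (M n : Set X) := by
    ext x
    simp [hmemS]
  have hclS : (S.topologicalClosure : Set X) = closure S := S.topologicalClosure_coe
  have hhull : ∀ x ∈ S, ∀ z ∈ S, ∀ ε > 0, z ∈ closure (convexHull ℝ
      (almostAdditiveSet x z ε ∩ (S.topologicalClosure : Set X))) := by
    intro x hx z hz ε hε
    obtain ⟨m, hm⟩ := (hmemS x).1 hx
    obtain ⟨k, hk⟩ := (hmemS z).1 hz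
    have h1 := hnext (M (max m k)) (hMsep _) x (hmono (le_max_left _ _) hm) z
      (hmono (le_max_right _ _) hk) ε hε
    rw [← hMs] at h1
    refine closure_mono (convexHull_mono (inter_subset_inter_right _ ?_)) h1
    exact (le_iSup M _).trans S.le_topologicalClosure
  refine ⟨S.topologicalClosure, S.isClosed_topologicalClosure, ?_, ?_, ?_⟩
  · rw [hclS, hSeq]
    exact (TopologicalSpace.IsSeparable.iUnion hMsep).closure
  · refine ⟨⟨⟨x₀, S.le_topologicalClosure ((hmemS x₀).2 ⟨0, ?_⟩)⟩, 0, ?_⟩⟩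
    · exact Submodule.mem_span_singleton_self x₀
    · simpa [Subtype.ext_iff] using hx₀
  · intro x z ε hε
    have h1 := mem_closure_convexHull_almostAdditiveSet_of_mem_closure hhull (x := (x : X))
      (z := (z : X)) (hclS ▸ x.2) (hclS ▸ z.2) hε
    have h2 : ((↑) : S.topologicalClosure → X) '' convexHull ℝ (almostAdditiveSet x z ε) =
        convexHull ℝ (almostAdditiveSet (x : X) z ε ∩ (S.topologicalClosure : Set X)) := by
      have := S.topologicalClosure.subtype.image_convexHull (almostAdditiveSet x z ε)
      rw [Submodule.coe_subtype] at this
      rw [this]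
      congr 1
      ext y
      constructor
      · rintro ⟨y, hy, rfl⟩
        exact ⟨hy, y.2⟩
      · rintro ⟨hy, hyS⟩
        exact ⟨⟨y, hyS⟩, hy, rfl⟩
    rw [← h2] at h1
    exact closure_subtype.2 h1

end SeparableSubspace

/-! ### Transport of SCD and of its failure along embeddings -/

section Cuts

variable {X Z : Type*} [NormedAddCommGroup X] [NormedSpace ℝ X] [NormedAddCommGroup Z]
  [NormedSpace ℝ Z]

/-- No sequence of non-empty intersections of `A` with open half-spaces determines `A`. Here the
zero functional is allowed. -/
def EscapesCuts (A : Set X) : Prop :=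
  ∀ (f : ℕ → X →L[ℝ] ℝ) (c : ℕ → ℝ), (∀ n, ∃ x ∈ A, c n < f n x) →
    ∃ B : Set X, (∀ n, ∃ x ∈ B, x ∈ A ∧ c n < f n x) ∧ ¬ A ⊆ closure (convexHull ℝ B)

theorem EscapesCuts.not_isSCD {A : Set X} (hA : EscapesCuts A) : ¬ IsSCD A := by
  rintro ⟨-, U, hU, -, hdet⟩
  choose hne f hf ε hε hUf using hU
  obtain ⟨B, hB, hAB⟩ := hA f (fun n => sSup (f n '' A) - ε n) fun n => by
    obtain ⟨x, hx⟩ := hne n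
    rw [hUf n] at hx
    exact ⟨x, hx⟩
  refine hAB (hdet B fun n => ?_)
  obtain ⟨x, hxB, hx⟩ := hB n
  exact ⟨x, hxB, by rw [hUf n]; exact hx⟩

theorem image_convexHull_continuousLinearMap (T : Z →L[ℝ] X) (B : Set Z) :
    T '' convexHull ℝ B = convexHull ℝ (T '' B) :=
  (T : Z →ₗ[ℝ] X).image_convexHull B

/-- A non-zero functional may become zero when composed with `T`; this is why the zero functional is
admitted in `EscapesCuts`. -/
theorem EscapesCuts.image {A : Set Z} (hA : EscapesCuts A) (T : Z →L[ℝ] X)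
    (hT : IsInducing T) : EscapesCuts (T '' A) := by
  intro f c hc
  obtain ⟨B, hB, hAB⟩ := hA (fun n => (f n).comp T) c fun n => by
    obtain ⟨_, ⟨x, hx, rfl⟩, hcx⟩ := hc n
    exact ⟨x, hx, hcx⟩
  refine ⟨T '' B, fun n => ?_, fun h => hAB fun x hx => ?_⟩
  · obtain ⟨x, hxB, hxA, hx⟩ := hB n
    exact ⟨T x, mem_image_of_mem T hxB, mem_image_of_mem T hxA, hx⟩
  · rw [hT.closure_eq_preimage_closure_image, mem_preimage, image_convexHull_continuousLinearMap]
    exact h (mem_image_of_mem T hx)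

/-- Since every functional on `Z` factors through `T`, the images of slices of `A` are slices of the
image. -/
theorem IsSCD.image {A : Set Z} (hA : IsSCD A) (T : Z →L[ℝ] X)
    (hT : ∀ f : Z →L[ℝ] ℝ, ∃ g : X →L[ℝ] ℝ, g.comp T = f) : IsSCD (T '' A) := by
  obtain ⟨hbdd, U, hU, hUA, hdet⟩ := hA
  refine ⟨T.lipschitz.isBounded_image hbdd, fun n => T '' U n, fun n => ?_, fun n => ?_, ?_⟩
  · obtain ⟨hne, f, hf, ε, hε, hUf⟩ := hU n
    obtain ⟨g, rfl⟩ := hT f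
    refine ⟨hne.image T, g, ?_, ε, hε, ?_⟩
    · rintro rfl
      exact hf (ContinuousLinearMap.zero_comp T)
    · have h1 : g '' (T '' A) = (g.comp T) '' A := by rw [image_image]; rfl
      change T '' U n = _
      rw [hUf]
      ext y
      constructor
      · rintro ⟨x, ⟨hxA, hx⟩, rfl⟩
        exact ⟨mem_image_of_mem T hxA, by rwa [h1]⟩
      · rintro ⟨⟨x, hxA, rfl⟩, hx⟩
        exact ⟨x, ⟨hxA, by rwa [h1] at hx⟩, rfl⟩
  · exact ⟨(hUA n).1.image T, image_mono (hUA n).2⟩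
  · intro B hB
    have h1 : A ⊆ closure (convexHull ℝ (T ⁻¹' B)) := hdet _ fun n => by
      obtain ⟨_, hyB, ⟨x, hx, rfl⟩⟩ := hB n
      exact ⟨x, hyB, hx⟩
    calc T '' A ⊆ T '' closure (convexHull ℝ (T ⁻¹' B)) := image_mono h1
      _ ⊆ closure (T '' convexHull ℝ (T ⁻¹' B)) := image_closure_subset_closure_image T.continuous
      _ ⊆ closure (convexHull ℝ B) := by
        rw [image_convexHull_continuousLinearMap]
        exact closure_mono (convexHull_mono (image_preimage_subset T B))

theorem IsSymmetricConvexClosedBounded.image {A : Set Z} (hA : IsSymmetricConvexClosedBounded A)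
    (T : Z →L[ℝ] X) (hT : IsClosedEmbedding T) : IsSymmetricConvexClosedBounded (T '' A) where
  convex := hA.convex.linear_image (T : Z →ₗ[ℝ] X)
  isClosed := hT.isClosedMap _ hA.isClosed
  isBounded := T.lipschitz.isBounded_image hA.isBounded
  neg_mem := by
    rintro _ ⟨x, hx, rfl⟩
    exact ⟨-x, hA.neg_mem x hx, map_neg T x⟩

end Cuts

/-! ### The box is not SCD -/

section Box

variable {X Q : Type*} [NormedAddCommGroup X] [NormedSpace ℝ X] [NormedAddCommGroup Q]
  [NormedSpace ℝ Q]

variable (Q) in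
/-- The unit ball of the `ℓ_∞`-sum of `Q` and the plane. -/
def unitBox : Set (Q × ℝ × ℝ) :=
  {p | ‖p.1‖ ≤ 1 ∧ |p.2.1| ≤ 1 ∧ |p.2.2| ≤ 1}

/-- The hypotheses on `π` describe a quotient map with finite-dimensional kernel. Vectors are chosen
upstairs in `X`, where almost orthogonality is available; putting the kernel into the first subspace
turns distances in `X` into distances in `Q`. -/
theorem HasDaugavetHullProperty.escapesCuts_unitBox [Nontrivial X]
    (hX : HasDaugavetHullProperty X) (π : X →L[ℝ] Q) (hπ1 : ∀ x, ‖π x‖ ≤ ‖x‖)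
    (hπ : ∀ (q : Q) (r : ℝ), ‖q‖ < r → ∃ x, ‖x‖ < r ∧ π x = q)
    (hker : FiniteDimensional ℝ π.ker) : EscapesCuts (unitBox Q) := by
  intro F c hc
  choose p hp hcp using hc
  -- The `n`-th choice costs a factor `w (n + 1) / w n`. These telescope from `w 0 = 1`, so the
  -- total loss never exceeds one half.
  set w : ℕ → ℝ := fun n => 1 / 2 + 1 / (n + 2) with hw
  have hw0 : w 0 = 1 := by norm_num [hw]
  have hwhalf : ∀ n, 1 / 2 < w n := fun n => by
    have : (0 : ℝ) < 1 / ((n : ℝ) + 2) := by positivity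
    simp only [hw]
    linarith
  have hwpos : ∀ n, 0 < w n := fun n => by linarith [hwhalf n]
  have hwlt : ∀ n, w (n + 1) < w n := fun n => by
    simp only [hw]
    push_cast
    gcongr
    linarith
  have hchoice : ∀ (n : ℕ) (H : Submodule ℝ X), FiniteDimensional ℝ H → ∃ b : X, ‖b‖ ≤ 1 ∧
      c n < F n (π b, (p n).2) ∧
      ∀ v ∈ H, ∀ t : ℝ, w (n + 1) * ‖v‖ ≤ w n * ‖v + t • b‖ := by
    intro n H hH
    have hF : ∀ q : Q, F n (q, (p n).2) =
        (F n).comp (ContinuousLinearMap.inl ℝ Q (ℝ × ℝ)) q + F n (0, (p n).2) := fun q => by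
      simp [← map_add]
    set φ := (F n).comp (ContinuousLinearMap.inl ℝ Q (ℝ × ℝ)) with hφ
    obtain ⟨q, hq, hcq⟩ : ∃ q : Q, ‖q‖ < 1 ∧ c n - F n (0, (p n).2) < φ q := by
      have h1 : c n - F n (0, (p n).2) < φ (p n).1 := by
        have := hcp n
        rw [show p n = ((p n).1, (p n).2) from rfl, hF] at this
        linarith
      -- Only the open ball of `Q` lifts to the ball of `X`, so `(p n).1` is shrunk slightly, which
      -- keeps the strict inequality.
      have h2 : Tendsto (fun s : ℝ => φ (s • (p n).1)) (𝓝[<] 1) (𝓝 (φ (p n).1)) := by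
        have : Continuous fun s : ℝ => φ (s • (p n).1) := by fun_prop
        have h3 := this.tendsto 1
        rw [one_smul] at h3
        exact h3.mono_left nhdsWithin_le_nhds
      obtain ⟨s, hs1, hs2⟩ := ((h2.eventually (lt_mem_nhds h1)).and
        (Ioo_mem_nhdsLT (zero_lt_one' ℝ))).exists
      refine ⟨s • (p n).1, ?_, hs1⟩
      rw [norm_smul, Real.norm_of_nonneg hs2.1.le]
      exact (mul_le_of_le_one_right hs2.1.le (hp n).1).trans_lt hs2.2
    obtain ⟨y, hy, rfl⟩ := hπ q 1 hq
    obtain ⟨b, hb, hcb, hbH⟩ := hX.exists_mem_cut_norm_add_smul (φ := φ.comp π)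
      ⟨y, hy.le, hcq⟩ H (κ := w (n + 1) / w n)
      (div_nonneg (hwpos _).le (hwpos _).le) ((div_lt_one (hwpos n)).2 (hwlt n))
    refine ⟨b, hb, ?_, fun v hv t => ?_⟩
    · rw [hF]
      have : c n - F n (0, (p n).2) < φ (π b) := hcb
      linarith
    · have h1 := mul_le_mul_of_nonneg_left (hbH v hv t) (hwpos n).le
      rwa [← mul_assoc, mul_div_cancel₀ _ (hwpos n).ne'] at h1
  obtain ⟨x₀, hx₀, hπx₀⟩ : ∃ x₀ : X, ‖x₀‖ ≤ 1 ∧ π x₀ ≠ 0 := by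
    have h1 : ∃ x, π x ≠ 0 := by
      by_contra! h
      have : π.ker = ⊤ := by
        ext x
        simp [h x]
      rw [this] at hker
      exact hX.not_finiteDimensional (Module.finite_def.2 (Module.Finite.iff_fg.1 hker))
    obtain ⟨x, hx⟩ := h1
    obtain ⟨e, he, hxe⟩ := exists_norm_eq_one_smul_eq x
    refine ⟨e, he.le, fun h => hx ?_⟩
    rw [hxe, map_smul, h, smul_zero]
  choose! b hb1 hcb hbH using hchoice
  -- Each new vector is almost orthogonal to `H n` together with `x₀`, but only the new vector is
  -- adjoined, so `x₀` stays away from every `H n`.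
  set H : ℕ → Submodule ℝ X := fun n => Nat.rec π.ker (fun n H => H ⊔ ℝ ∙ b n (H ⊔ ℝ ∙ x₀)) n
    with hHdef
  have hH0 : H 0 = π.ker := rfl
  have hHs : ∀ n, H (n + 1) = H n ⊔ ℝ ∙ b n (H n ⊔ ℝ ∙ x₀) := fun n => rfl
  have hHfin : ∀ n, FiniteDimensional ℝ (H n) := by
    intro n
    induction n with
    | zero => exact hker
    | succ n ih => rw [hHs]; infer_instance
  set a : ℕ → X := fun n => b n (H n ⊔ ℝ ∙ x₀) with ha
  have haH : ∀ n, ∀ v ∈ H n ⊔ ℝ ∙ x₀, ∀ t : ℝ, w (n + 1) * ‖v‖ ≤ w n * ‖v + t • a n‖ := by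
    intro n
    have := hHfin n
    exact hbH n _ inferInstance
  have hmono : Monotone H := monotone_nat_of_le_succ fun n => by rw [hHs]; exact le_sup_left
  set d := ‖π x₀‖ with hd
  have hd0 : 0 < d := norm_pos_iff.2 hπx₀
  have hdist : ∀ n, ∀ v ∈ H n, w n * d ≤ ‖x₀ - v‖ := by
    intro n
    induction n with
    | zero =>
      intro v hv
      have h1 := hπ1 (x₀ - v)
      rw [map_sub, show π v = 0 from hv, sub_zero] at h1
      rwa [hw0, one_mul]
    | succ n ih =>
      intro v hv
      rw [hHs] at hv
      obtain ⟨u, hu, y, hy, rfl⟩ := Submodule.mem_sup.1 hv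
      obtain ⟨t, rfl⟩ := Submodule.mem_span_singleton.1 hy
      have h1 := haH n (x₀ - u) (Submodule.sub_mem _
        (Submodule.mem_sup_right (Submodule.mem_span_singleton_self x₀))
        (Submodule.mem_sup_left hu)) (-t)
      rw [neg_smul, ← sub_eq_add_neg, sub_sub] at h1
      have h2 := mul_le_mul_of_nonneg_left (ih u hu) (hwpos (n + 1)).le
      refine le_of_mul_le_mul_left ?_ (hwpos n)
      calc w n * (w (n + 1) * d) = w (n + 1) * (w n * d) := by ring
        _ ≤ _ := h2.trans h1
  set V : Submodule ℝ X := ⨆ n, H n with hV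
  have hVdist : ∀ v ∈ V, d / 2 ≤ ‖x₀ - v‖ := by
    intro v hv
    obtain ⟨n, hn⟩ := (Submodule.mem_iSup_of_directed H hmono.directed_le).1 hv
    have h1 := hdist n v hn
    have h2 := mul_le_mul_of_nonneg_right (hwhalf n).le hd0.le
    linarith
  have haV : ∀ n, a n ∈ V := fun n => le_iSup H (n + 1) (by
    rw [hHs]; exact Submodule.mem_sup_right (Submodule.mem_span_singleton_self _))
  refine ⟨range fun n => (π (a n), (p n).2), fun n => ⟨_, mem_range_self n, ?_, ?_⟩, fun hsub => ?_⟩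
  · have := hHfin n
    exact ⟨(hπ1 _).trans (hb1 n _ inferInstance), (hp n).2⟩
  · have := hHfin n
    exact hcb n _ inferInstance
  · have hmem : ((π x₀, 0, 0) : Q × ℝ × ℝ) ∈ unitBox Q :=
      ⟨(hπ1 x₀).trans hx₀, by simp, by simp⟩
    obtain ⟨y, hy, hdy⟩ := Metric.mem_closure_iff.1 (hsub hmem) (d / 2) (by positivity)
    have h1 : convexHull ℝ (range fun n => (π (a n), (p n).2)) ⊆
        ((V.map (π : X →ₗ[ℝ] Q)).comap (LinearMap.fst ℝ Q (ℝ × ℝ)) : Set (Q × ℝ × ℝ)) := by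
      refine convexHull_min ?_ (Submodule.convex _)
      rintro _ ⟨n, rfl⟩
      exact Submodule.mem_map_of_mem (f := (π : X →ₗ[ℝ] Q)) (haV n)
    obtain ⟨v, hv, hvy⟩ := h1 hy
    have h2 : ‖π (x₀ - v)‖ < d / 2 := by
      rw [map_sub, show π v = y.1 from hvy]
      rw [dist_eq_norm] at hdy
      exact (norm_fst_le _).trans_lt hdy
    obtain ⟨x, hx, hπx⟩ := hπ _ _ h2
    have h3 : x₀ - x ∈ V := by
      have h4 : x₀ - v - x ∈ H 0 := by
        rw [hH0]
        change π _ = 0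
        rw [map_sub, hπx, sub_self]
      have := V.add_mem hv (le_iSup H 0 h4)
      rwa [show v + (x₀ - v - x) = x₀ - x by abel] at this
    have h5 := hVdist _ h3
    rw [sub_sub_cancel] at h5
    linarith

end Box

/-! ### SCD sets from strongly exposed points -/

section StronglyExposed

variable {X : Type*} [NormedAddCommGroup X] [NormedSpace ℝ X]

/-- The closed convex hull of a bounded countable set all of whose points are strongly exposed
is slicely countably determined. -/
theorem isSCD_closure_convexHull_of_stronglyExposed {E : Set X} (hE : E.Countable)
    (hne : E.Nonempty) (hbdd : Bornology.IsBounded E)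
    (h : ∀ p ∈ E, ∃ F : X →L[ℝ] ℝ, F ≠ 0 ∧ ∃ K : ℝ, 0 < K ∧ ∀ d ∈ E, ‖d - p‖ ≤ K * (F p - F d)) :
    IsSCD (closure (convexHull ℝ E)) := by
  obtain ⟨e, rfl⟩ := hE.exists_eq_range hne
  set C := closure (convexHull ℝ (range e)) with hC
  choose F hF0 K hK0 hFK using fun n => h (e n) (mem_range_self n)
  have heC : ∀ n, e n ∈ C := fun n => subset_closure (subset_convexHull ℝ _ (mem_range_self n))
  have hexp : ∀ n, ∀ x ∈ C, ‖x - e n‖ ≤ K n * (F n (e n) - F n x) := by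
    intro n
    -- The exposing inequality bounds a continuous convex function from above, so it passes from the
    -- points to their closed convex hull.
    have hconv : ConvexOn ℝ univ fun x => ‖x - e n‖ + K n * F n x := by
      refine ConvexOn.add ?_ ?_
      · have := (convexOn_univ_norm (E := X)).translate_left (-e n)
        simpa [Function.comp_def, sub_eq_add_neg] using this
      · exact ((K n • F n : X →L[ℝ] ℝ) : X →ₗ[ℝ] ℝ).convexOn convex_univ
    have hsub : C ⊆ {x | ‖x - e n‖ + K n * F n x ≤ K n * F n (e n)} := by
      refine closure_minimal (convexHull_min ?_ ?_) (isClosed_le (by fun_prop) continuous_const)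
      · intro d hd
        have := hFK n d hd
        change ‖d - e n‖ + K n * F n d ≤ K n * F n (e n)
        linarith
      · simpa using hconv.convex_le (K n * F n (e n))
    intro x hx
    have : ‖x - e n‖ + K n * F n x ≤ K n * F n (e n) := hsub hx
    linarith
  have hle : ∀ n, ∀ x ∈ C, F n x ≤ F n (e n) := by
    intro n x hx
    have h1 := (norm_nonneg _).trans (hexp n x hx)
    exact sub_nonneg.1 (nonneg_of_mul_nonneg_right h1 (hK0 n))
  have hsup : ∀ n, sSup (F n '' C) = F n (e n) := fun n =>
    IsGreatest.csSup_eq ⟨mem_image_of_mem _ (heC n), by rintro _ ⟨x, hx, rfl⟩; exact hle n x hx⟩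
  set ε : ℕ → ℕ → ℝ := fun n j => 1 / ((j : ℝ) + 1) / K n with hε
  have hε0 : ∀ n j, 0 < ε n j := fun n j => div_pos Nat.one_div_pos_of_nat (hK0 n)
  have hslice : ∀ n j, (sliceSet C (F n) (ε n j)).Nonempty := fun n j =>
    ⟨e n, heC n, by rw [hsup]; linarith [hε0 n j]⟩
  refine ⟨((isBounded_convexHull).2 hbdd).closure,
    fun m => sliceSet C (F m.unpair.1) (ε m.unpair.1 m.unpair.2),
    fun m => ⟨hslice _ _, _, hF0 _, _, hε0 _ _, rfl⟩, fun m => ⟨hslice _ _, fun x hx => hx.1⟩, ?_⟩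
  intro B hB
  refine closure_minimal (convexHull_min ?_ (convex_convexHull ℝ B).closure) isClosed_closure
  rintro _ ⟨n, rfl⟩
  refine closure_mono (subset_convexHull ℝ B) (Metric.mem_closure_iff.2 fun r hr => ?_)
  obtain ⟨j, hj⟩ := exists_nat_one_div_lt hr
  obtain ⟨x, hxB, hxC, hx⟩ := hB (Nat.pair n j)
  rw [Nat.unpair_pair] at hx
  simp only [hsup] at hx
  refine ⟨x, hxB, ?_⟩
  rw [dist_eq_norm, norm_sub_rev]
  refine (hexp n x hxC).trans_lt (lt_of_le_of_lt ?_ hj)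
  have h1 : F n (e n) - F n x ≤ ε n j := by linarith
  calc K n * (F n (e n) - F n x) ≤ K n * ε n j := mul_le_mul_of_nonneg_left h1 (hK0 n).le
    _ = 1 / ((j : ℝ) + 1) := mul_div_cancel₀ _ (hK0 n).ne'

end StronglyExposed

/-- Each term of a dense sequence is repeated infinitely often, so a direction can be approximated
at late indices, where the spikes are low. -/
theorem exists_seq_norm_eq_one_frequently_dist_lt (Q : Type*) [NormedAddCommGroup Q]
    [NormedSpace ℝ Q] [Nontrivial Q] [TopologicalSpace.SeparableSpace Q] :
    ∃ y : ℕ → Q, (∀ n, ‖y n‖ = 1) ∧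
      ∀ q : Q, ‖q‖ = 1 → ∀ ε > 0, ∀ N : ℕ, ∃ n ≥ N, ‖y n - q‖ < ε := by
  have : Nonempty (Metric.sphere (0 : Q) 1) := by
    obtain ⟨z, hz⟩ := exists_norm_eq Q zero_le_one
    exact ⟨z, by simpa using hz⟩
  have : TopologicalSpace.SeparableSpace (Metric.sphere (0 : Q) 1) :=
    (TopologicalSpace.IsSeparable.of_separableSpace _).separableSpace
  refine ⟨fun n => TopologicalSpace.denseSeq (Metric.sphere (0 : Q) 1) n.unpair.1,
    fun n => by simp, fun q hq ε hε N => ?_⟩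
  obtain ⟨i, hi⟩ := (TopologicalSpace.denseRange_denseSeq (Metric.sphere (0 : Q) 1)).exists_dist_lt
    ⟨q, by simpa using hq⟩ hε
  refine ⟨Nat.pair i N, Nat.right_le_pair i N, ?_⟩
  beta_reduce
  rw [Nat.unpair_pair, norm_sub_rev, ← dist_eq_norm]
  exact hi

/-! ### The spike body -/

section Spikes

variable {Q : Type*} [NormedAddCommGroup Q] [NormedSpace ℝ Q]

/-- The heights of the spikes above the unit box. -/
noncomputable def spikeHeight (n : ℕ) : ℝ := 1 / ((n : ℝ) + 2)

theorem spikeHeight_pos (n : ℕ) : 0 < spikeHeight n := by unfold spikeHeight; positivity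

theorem spikeHeight_le (n : ℕ) : spikeHeight n ≤ 1 / 2 := by
  unfold spikeHeight
  gcongr
  linarith [n.cast_nonneg (α := ℝ)]

theorem exists_pos_forall_ne_le_sq_sub_spikeHeight (n : ℕ) :
    ∃ ρ > 0, ∀ m ≠ n, ρ ≤ (spikeHeight m - spikeHeight n) ^ 2 := by
  -- The height nearest to the `n`-th one is the next, at distance `1 / ((n + 2) (n + 3))`.
  refine ⟨(spikeHeight n / ((n : ℝ) + 3)) ^ 2, by have := spikeHeight_pos n; positivity,
    fun m hm => ?_⟩
  rw [sq_le_sq]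
  have hn : (0 : ℝ) ≤ n := n.cast_nonneg
  have hm0 : (0 : ℝ) ≤ m := m.cast_nonneg
  have h1 : spikeHeight m - spikeHeight n = ((n : ℝ) - m) / (((m : ℝ) + 2) * ((n : ℝ) + 2)) := by
    unfold spikeHeight
    field_simp
    ring
  have h2 : (1 : ℝ) ≤ |(n : ℝ) - m| := by
    have : (1 : ℤ) ≤ |(n : ℤ) - m| := Int.one_le_abs (by omega)
    exact_mod_cast this
  have h3 : (m : ℝ) ≤ n + |(n : ℝ) - m| := by linarith [neg_abs_le ((n : ℝ) - m)]
  rw [h1, abs_div, abs_div, abs_of_pos (spikeHeight_pos n),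
    abs_of_pos (by positivity : 0 < (n : ℝ) + 3),
    abs_of_pos (by positivity : 0 < ((m : ℝ) + 2) * ((n : ℝ) + 2))]
  unfold spikeHeight
  rw [div_div, div_le_div_iff₀ (by positivity) (by positivity)]
  have h4 : (m : ℝ) + 2 ≤ |(n : ℝ) - m| * (n + 3) := by
    have := mul_nonneg hn (sub_nonneg.2 h2)
    linarith
  have h5 := mul_le_mul_of_nonneg_right h4 (by positivity : (0 : ℝ) ≤ n + 2)
  linarith

/-- The tips of the spikes over the points `±y n`. -/
def spikeTips (y : ℕ → Q) : Set (Q × ℝ × ℝ) :=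
  ⋃ n, (fun s : ℝ × ℝ × ℝ => ((s.1 * (1 - spikeHeight n ^ 2)) • y n,
    s.2.1 * (1 + spikeHeight n), s.2.2)) '' ({1, -1} ×ˢ {1, -1} ×ˢ {1, -1})

/-- The closed convex hull of the tips of all spikes. -/
def spikeBody (y : ℕ → Q) : Set (Q × ℝ × ℝ) := closure (convexHull ℝ (spikeTips y))

theorem mem_spikeTips {y : ℕ → Q} {p : Q × ℝ × ℝ} :
    p ∈ spikeTips y ↔ ∃ n, ∃ σ₁ σ₂ σ₃ : ℝ, |σ₁| = 1 ∧ |σ₂| = 1 ∧ |σ₃| = 1 ∧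
      p = ((σ₁ * (1 - spikeHeight n ^ 2)) • y n, σ₂ * (1 + spikeHeight n), σ₃) := by
  simp only [spikeTips, mem_iUnion, mem_image, Prod.exists, mem_prod, mem_insert_iff,
    mem_singleton_iff, abs_eq (zero_le_one' ℝ)]
  constructor
  · rintro ⟨n, σ₁, σ₂, σ₃, ⟨h1, h2, h3⟩, rfl⟩
    exact ⟨n, σ₁, σ₂, σ₃, h1, h2, h3, rfl⟩
  · rintro ⟨n, σ₁, σ₂, σ₃, h1, h2, h3, rfl⟩
    exact ⟨n, σ₁, σ₂, σ₃, ⟨h1, h2, h3⟩, rfl⟩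

theorem countable_spikeTips (y : ℕ → Q) : (spikeTips y).Countable :=
  countable_iUnion fun _ =>
    (((toFinite _).prod ((toFinite _).prod (toFinite _))).image _).countable

theorem spikeTips_subset {y : ℕ → Q} (hy : ∀ n, ‖y n‖ = 1) :
    spikeTips y ⊆ Metric.closedBall 0 1 ×ˢ (Metric.closedBall 0 2 ×ˢ Metric.closedBall 0 1) := by
  intro p hp
  obtain ⟨n, σ₁, σ₂, σ₃, h1, h2, h3, rfl⟩ := mem_spikeTips.1 hp
  have hu := spikeHeight_pos n
  have hu' := spikeHeight_le n
  have hr : 0 ≤ 1 - spikeHeight n ^ 2 := by nlinarith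
  simp only [mem_prod, mem_closedBall_zero_iff, norm_smul, hy, mul_one, norm_mul, Real.norm_eq_abs,
    h1, h2, h3, one_mul, abs_of_nonneg hr, abs_of_pos (by linarith : 0 < 1 + spikeHeight n)]
  exact ⟨by nlinarith, by linarith, le_rfl⟩

theorem spikeBody_subset {y : ℕ → Q} (hy : ∀ n, ‖y n‖ = 1) :
    spikeBody y ⊆ Metric.closedBall 0 1 ×ˢ (Metric.closedBall 0 2 ×ˢ Metric.closedBall 0 1) :=
  closure_minimal
    (convexHull_min (spikeTips_subset hy)
      ((convex_closedBall _ _).prod ((convex_closedBall _ _).prod (convex_closedBall _ _))))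
    (Metric.isClosed_closedBall.prod (Metric.isClosed_closedBall.prod Metric.isClosed_closedBall))

theorem isBounded_prod_closedBall {E : Type*} [NormedAddCommGroup E] : Bornology.IsBounded
    (Metric.closedBall (0 : E) 1 ×ˢ (Metric.closedBall (0 : ℝ) 2 ×ˢ Metric.closedBall (0 : ℝ) 1)) :=
  Metric.isBounded_closedBall.prod (Metric.isBounded_closedBall.prod Metric.isBounded_closedBall)

theorem isSymmetricConvexClosedBounded_spikeBody {y : ℕ → Q} (hy : ∀ n, ‖y n‖ = 1) :
    IsSymmetricConvexClosedBounded (spikeBody y) where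
  convex := (convex_convexHull ℝ _).closure
  isClosed := isClosed_closure
  isBounded := isBounded_prod_closedBall.subset (spikeBody_subset hy)
  neg_mem := by
    have h1 : -spikeTips y = spikeTips y := by
      have h2 : ∀ p ∈ spikeTips y, -p ∈ spikeTips y := by
        intro p hp
        obtain ⟨n, σ₁, σ₂, σ₃, h1, h2, h3, rfl⟩ := mem_spikeTips.1 hp
        refine mem_spikeTips.2 ⟨n, -σ₁, -σ₂, -σ₃, by rwa [abs_neg], by rwa [abs_neg],
          by rwa [abs_neg], ?_⟩
        simp
      exact Subset.antisymm (fun p hp => neg_neg p ▸ h2 _ hp) h2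
    intro x hx
    rw [spikeBody, ← h1, convexHull_neg, ← neg_closure, Set.mem_neg, neg_neg]
    exact hx

theorem Convex.add_smul_mem_of_abs_le_one {E : Type*} [AddCommGroup E] [Module ℝ E] {C : Set E}
    (hC : Convex ℝ C) {p v : E} (h1 : p + v ∈ C) (h2 : p - v ∈ C) {a : ℝ} (ha : |a| ≤ 1) :
    p + a • v ∈ C := by
  obtain ⟨h3, h4⟩ := abs_le.1 ha
  have := hC h1 h2 (by linarith : 0 ≤ (1 + a) / 2) (by linarith : 0 ≤ (1 - a) / 2) (by ring)
  convert this using 1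
  module

/-- Tips with late indices approach every `(q, ±1, ±1)` with `‖q‖ = 1`; convexity fills in first the
scalars and then the segment from `-q` to `q`. -/
theorem unitBox_subset_spikeBody [Nontrivial Q] {y : ℕ → Q}
    (hdense : ∀ q : Q, ‖q‖ = 1 → ∀ ε > 0, ∀ N : ℕ, ∃ n ≥ N, ‖y n - q‖ < ε)
    (hy : ∀ n, ‖y n‖ = 1) : unitBox Q ⊆ spikeBody y := by
  have hconv : Convex ℝ (spikeBody y) := (convex_convexHull ℝ _).closure
  have hvert : ∀ (q : Q) (σ₂ σ₃ : ℝ), ‖q‖ = 1 → |σ₂| = 1 → |σ₃| = 1 →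
      (q, σ₂, σ₃) ∈ spikeBody y := by
    intro q σ₂ σ₃ hq h2 h3
    refine closure_mono (subset_convexHull ℝ _) (Metric.mem_closure_iff.2 fun ε hε => ?_)
    obtain ⟨N, hN⟩ := exists_nat_one_div_lt (half_pos hε)
    obtain ⟨n, hn, hnq⟩ := hdense q hq (ε / 2) (half_pos hε) N
    have hu := spikeHeight_pos n
    have hu' := spikeHeight_le n
    have hun : spikeHeight n < ε / 2 := by
      refine lt_of_le_of_lt ?_ hN
      unfold spikeHeight
      have : (N : ℝ) ≤ n := by exact_mod_cast hn
      gcongr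
      linarith
    refine ⟨_, mem_spikeTips.2 ⟨n, 1, σ₂, σ₃, abs_one, h2, h3, rfl⟩, ?_⟩
    rw [dist_comm, Prod.dist_eq, Prod.dist_eq]
    refine max_lt ?_ (max_lt ?_ (by simpa using hε))
    · have h4 : (1 * (1 - spikeHeight n ^ 2)) • y n - q =
          (y n - q) + (-(spikeHeight n ^ 2)) • y n := by module
      have h5 := norm_add_le (y n - q) ((-(spikeHeight n ^ 2)) • y n)
      rw [norm_smul, hy, mul_one, norm_neg, Real.norm_of_nonneg (by positivity)] at h5
      rw [dist_eq_norm, h4]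
      nlinarith
    · rw [Real.dist_eq, show σ₂ * (1 + spikeHeight n) - σ₂ = σ₂ * spikeHeight n by ring, abs_mul, h2,
        one_mul, abs_of_pos hu]
      linarith
  have hside : ∀ (q : Q) (s σ₃ : ℝ), ‖q‖ = 1 → |s| ≤ 1 → |σ₃| = 1 → (q, s, σ₃) ∈ spikeBody y := by
    intro q s σ₃ hq hs h3
    have := hconv.add_smul_mem_of_abs_le_one (p := (q, 0, σ₃)) (v := (0, 1, 0))
      (by simpa using hvert q 1 σ₃ hq (by simp) h3)
      (by simpa using hvert q (-1) σ₃ hq (by simp) h3) hs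
    simpa using this
  have hface : ∀ (q : Q) (s t : ℝ), ‖q‖ = 1 → |s| ≤ 1 → |t| ≤ 1 → (q, s, t) ∈ spikeBody y := by
    intro q s t hq hs ht
    have := hconv.add_smul_mem_of_abs_le_one (p := (q, s, 0)) (v := (0, 0, 1))
      (by simpa using hside q s 1 hq hs (by simp))
      (by simpa using hside q s (-1) hq hs (by simp)) ht
    simpa using this
  rintro ⟨q, s, t⟩ ⟨hq, hs, ht⟩
  obtain ⟨e, he, hqe⟩ := exists_norm_eq_one_smul_eq q
  have := hconv.add_smul_mem_of_abs_le_one (p := (0, s, t)) (v := (e, 0, 0)) (a := ‖q‖)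
    (by simpa using hface e s t he hs ht)
    (by simpa using hface (-e) s t (by rwa [norm_neg]) hs ht) (by rwa [abs_norm])
  rw [hqe]
  simpa using this

theorem mul_eq_one_or_eq_neg_one {a b : ℝ} (ha : |a| = 1) (hb : |b| = 1) :
    a = b ∧ a * b = 1 ∨ a * b = -1 := by
  rcases (abs_eq zero_le_one).1 ha with rfl | rfl <;>
    rcases (abs_eq zero_le_one).1 hb with rfl | rfl <;> norm_num

theorem mul_le_one_of_abs_eq_one {a b : ℝ} (ha : |a| = 1) (hb : |b| = 1) : a * b ≤ 1 := by
  rcases mul_eq_one_or_eq_neg_one ha hb with h | h <;> linarith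

theorem isSCD_spikeBody {y : ℕ → Q} (hy : ∀ n, ‖y n‖ = 1) : IsSCD (spikeBody y) := by
  have hbdd := isBounded_prod_closedBall.subset (spikeTips_subset hy)
  refine isSCD_closure_convexHull_of_stronglyExposed (countable_spikeTips y)
    ⟨_, mem_spikeTips.2 ⟨0, 1, 1, 1, abs_one, abs_one, abs_one, rfl⟩⟩ hbdd fun p hp => ?_
  obtain ⟨D, hD0, hD⟩ : ∃ D : ℝ, 0 < D ∧ ∀ d ∈ spikeTips y, ‖d - p‖ ≤ D := by
    obtain ⟨D, hD⟩ := hbdd.exists_norm_le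
    refine ⟨max (D + D) 1, by positivity, fun d hd => le_max_of_le_left ?_⟩
    exact (norm_sub_le _ _).trans (add_le_add (hD d hd) (hD p hp))
  obtain ⟨n, σ₁, σ₂, σ₃, h1, h2, h3, rfl⟩ := mem_spikeTips.1 hp
  obtain ⟨f, hf, hfy⟩ := exists_dual_vector'' ℝ (y n)
  rw [hy] at hfy
  have hfy' : f (y n) = 1 := hfy
  have hfle : ∀ m, |f (y m)| ≤ 1 := fun m =>
    (f.le_opNorm (y m)).trans (by rw [hy, mul_one]; exact hf)
  set u := spikeHeight n with hu
  have hu0 : 0 < u := spikeHeight_pos n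
  have hu1 : u ≤ 1 / 2 := spikeHeight_le n
  obtain ⟨ρ, hρ0, hρ⟩ := exists_pos_forall_ne_le_sq_sub_spikeHeight n
  -- With this slope the concave function `v ↦ k * (1 - v ^ 2) + (1 + v)` is maximal at `v = u`,
  -- with deficit `k * (v - u) ^ 2` elsewhere.
  set k := 1 / (2 * u) with hk
  have hk0 : 0 < k := by positivity
  have hku : 2 * (k * u) = 1 := by rw [hk]; field_simp
  have hk1 : 1 ≤ k := by nlinarith
  set F : Q × ℝ × ℝ →L[ℝ] ℝ := ((k * σ₁) • f).coprod
    ((σ₂ • ContinuousLinearMap.id ℝ ℝ).coprod (σ₃ • ContinuousLinearMap.id ℝ ℝ)) with hF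
  have hFapp : ∀ (q : Q) (s t : ℝ), F (q, s, t) = k * σ₁ * f q + (σ₂ * s + σ₃ * t) := by
    intro q s t
    simp [hF]
  have hsq : ∀ {a : ℝ}, |a| = 1 → a * a = 1 := fun {a} ha => by rw [← abs_mul_abs_self, ha, one_mul]
  refine ⟨F, ?_, ?_⟩
  · intro h0
    have h4 := hFapp 0 0 σ₃
    rw [h0] at h4
    simp [hsq h3] at h4
  -- A different height costs at least `k * ρ`; at the same height a wrong sign costs at least 1.
  set δ := min 1 (k * ρ) with hδ
  have hδ0 : 0 < δ := by positivity
  have hFp : F ((σ₁ * (1 - u ^ 2)) • y n, σ₂ * (1 + u), σ₃) = k * (1 - u ^ 2) + (1 + u) + 1 := by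
    rw [hFapp, map_smul, hfy', smul_eq_mul]
    linear_combination (k * (1 - u ^ 2)) * hsq h1 + (1 + u) * hsq h2 + hsq h3
  refine ⟨D / δ, by positivity, fun d hd => ?_⟩
  have hdD := hD d hd
  suffices h : d = ((σ₁ * (1 - u ^ 2)) • y n, σ₂ * (1 + u), σ₃) ∨
      δ ≤ F ((σ₁ * (1 - u ^ 2)) • y n, σ₂ * (1 + u), σ₃) - F d by
    rcases h with rfl | h
    · simp
    · refine hdD.trans ?_
      rw [div_mul_eq_mul_div, le_div_iff₀ hδ0]
      exact mul_le_mul_of_nonneg_left h hD0.le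
  obtain ⟨m, η₁, η₂, η₃, g1, g2, g3, rfl⟩ := mem_spikeTips.1 hd
  rw [hFp, hFapp, map_smul, smul_eq_mul]
  rcases eq_or_ne m n with rfl | hmn
  · rw [hfy', ← hu]
    have hr : 3 / 4 ≤ 1 - u ^ 2 := by nlinarith
    have hkr : 3 / 4 ≤ k * (1 - u ^ 2) := by nlinarith
    have i1 := mul_le_mul_of_nonneg_left (mul_le_one_of_abs_eq_one g1 h1)
      (by linarith : 0 ≤ k * (1 - u ^ 2))
    have i2 := mul_le_mul_of_nonneg_left (mul_le_one_of_abs_eq_one g2 h2)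
      (by linarith : 0 ≤ 1 + u)
    have i3 := mul_le_one_of_abs_eq_one g3 h3
    have hFd : k * σ₁ * (η₁ * (1 - u ^ 2) * 1) + (σ₂ * (η₂ * (1 + u)) + σ₃ * η₃) =
        k * (1 - u ^ 2) * (η₁ * σ₁) + (1 + u) * (η₂ * σ₂) + η₃ * σ₃ := by ring
    rw [hFd]
    have hδ1 : δ ≤ 1 := min_le_left _ _
    rcases mul_eq_one_or_eq_neg_one g1 h1 with ⟨rfl, e1⟩ | e1
    · rcases mul_eq_one_or_eq_neg_one g2 h2 with ⟨rfl, e2⟩ | e2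
      · rcases mul_eq_one_or_eq_neg_one g3 h3 with ⟨rfl, e3⟩ | e3
        · exact Or.inl rfl
        · right
          linarith
      · right
        rw [e2]
        linarith
    · right
      rw [e1]
      linarith
  · right
    set v := spikeHeight m with hv
    have hv0 : 0 < v := spikeHeight_pos m
    have hv1 : v ≤ 1 / 2 := spikeHeight_le m
    have hr : 0 ≤ 1 - v ^ 2 := by nlinarith
    have j1 : k * σ₁ * (η₁ * (1 - v ^ 2) * f (y m)) ≤ k * (1 - v ^ 2) := by
      have : σ₁ * η₁ * f (y m) ≤ 1 := by
        refine (le_abs_self _).trans ?_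
        rw [abs_mul, abs_mul, h1, g1, one_mul, one_mul]
        exact hfle m
      have h4 := mul_le_mul_of_nonneg_left this (mul_nonneg hk0.le hr)
      linarith
    have j2 : σ₂ * (η₂ * (1 + v)) ≤ 1 + v := by
      have h4 := mul_le_mul_of_nonneg_left (mul_le_one_of_abs_eq_one h2 g2)
        (by linarith : 0 ≤ 1 + v)
      linarith
    have j3 := mul_le_one_of_abs_eq_one h3 g3
    have j4 : δ ≤ k * (v - u) ^ 2 :=
      (min_le_right _ _).trans (mul_le_mul_of_nonneg_left (hρ m hmn) hk0.le)
    have j5 : k * (v - u) ^ 2 = k * (1 - u ^ 2) - k * (1 - v ^ 2) + (u - v) := by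
      linear_combination (u - v) * hku
    linarith

end Spikes

/-! ### Assembly of the two bodies -/

section Final

/-- Exchange of the two scalar coordinates. -/
def swapScalars (Q : Type*) [NormedAddCommGroup Q] [NormedSpace ℝ Q] :
    (Q × ℝ × ℝ) ≃L[ℝ] (Q × ℝ × ℝ) :=
  (ContinuousLinearEquiv.refl ℝ Q).prodCongr (ContinuousLinearEquiv.prodComm ℝ ℝ ℝ)

theorem exists_comp_equiv_eq {X Z : Type*} [NormedAddCommGroup X] [NormedSpace ℝ X]
    [NormedAddCommGroup Z] [NormedSpace ℝ Z] (e : Z ≃L[ℝ] X) (f : Z →L[ℝ] ℝ) :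
    ∃ g : X →L[ℝ] ℝ, g.comp (e : Z →L[ℝ] X) = f :=
  ⟨f.comp (e.symm : X →L[ℝ] Z), by ext x; simp⟩

theorem interior_image_equiv_nonempty {X Z : Type*} [NormedAddCommGroup X] [NormedSpace ℝ X]
    [NormedAddCommGroup Z] [NormedSpace ℝ Z] (e : Z ≃L[ℝ] X) {A : Set Z}
    (hA : (interior A).Nonempty) : (interior ((e : Z →L[ℝ] X) '' A)).Nonempty :=
  (hA.image e).mono (e.toHomeomorph.isOpenMap.image_interior_subset A)

theorem exists_isSCD_inter_eq_unitBox (Q : Type*) [NormedAddCommGroup Q] [NormedSpace ℝ Q]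
    [Nontrivial Q] [TopologicalSpace.SeparableSpace Q] :
    ∃ C₁ C₂ : Set (Q × ℝ × ℝ),
      IsSymmetricConvexClosedBounded C₁ ∧ (interior C₁).Nonempty ∧
      IsSymmetricConvexClosedBounded C₂ ∧ (interior C₂).Nonempty ∧
      IsSCD C₁ ∧ IsSCD C₂ ∧ C₁ ∩ C₂ = unitBox Q := by
  obtain ⟨y, hy, hdense⟩ := exists_seq_norm_eq_one_frequently_dist_lt Q
  have hbox := unitBox_subset_spikeBody hdense hy
  have hsub := spikeBody_subset hy
  have hint : (interior (spikeBody y)).Nonempty := by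
    refine ⟨0, mem_interior.2 ⟨Metric.ball 0 1, fun p hp => hbox ?_, Metric.isOpen_ball,
      Metric.mem_ball_self one_pos⟩⟩
    have hp1 : ‖p‖ < 1 := mem_ball_zero_iff.1 hp
    exact ⟨(norm_fst_le p).trans hp1.le, ((norm_fst_le p.2).trans (norm_snd_le p)).trans hp1.le,
      ((norm_snd_le p.2).trans (norm_snd_le p)).trans hp1.le⟩
  have hsym := isSymmetricConvexClosedBounded_spikeBody hy
  have hscd := isSCD_spikeBody hy
  refine ⟨spikeBody y, (swapScalars Q : (Q × ℝ × ℝ) →L[ℝ] (Q × ℝ × ℝ)) '' spikeBody y, hsym, hint,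
    hsym.image _ (swapScalars Q).toHomeomorph.isClosedEmbedding,
    interior_image_equiv_nonempty _ hint, hscd, hscd.image _ (exists_comp_equiv_eq _), ?_⟩
  refine Subset.antisymm ?_ fun p hp => ⟨hbox hp, (p.1, p.2.2, p.2.1), hbox ?_, rfl⟩
  -- Each body bounds by 1 the scalar coordinate along which the other one has its spikes.
  · rintro _ ⟨h1, ⟨p, hp, rfl⟩⟩
    have h2 := hsub h1
    have h3 := hsub hp
    exact ⟨mem_closedBall_zero_iff.1 h3.1, mem_closedBall_zero_iff.1 h3.2.2,
      mem_closedBall_zero_iff.1 h2.2.2⟩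
  · exact ⟨hp.1, hp.2.2, hp.2.1⟩

variable {X : Type*} [NormedAddCommGroup X] [NormedSpace ℝ X]

theorem exists_submodule_finrank_eq_two (hX : ¬ FiniteDimensional ℝ X) :
    ∃ G : Submodule ℝ X, FiniteDimensional ℝ G ∧ Module.finrank ℝ G = 2 := by
  have h1 : ((2 : ℕ) : Cardinal) ≤ Module.rank ℝ X := by
    refine (Cardinal.natCast_lt_aleph0 (n := 2)).le.trans (not_lt.1 fun h => hX ?_)
    exact Module.rank_lt_aleph0_iff.1 h
  obtain ⟨s, hs, hli⟩ := exists_finset_linearIndependent_of_le_rank h1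
  exact ⟨Submodule.span ℝ s, inferInstance, by rw [finrank_span_finset_eq_card hli, hs]⟩

theorem exists_equiv_quotient_prod [CompleteSpace X] (G : Submodule ℝ X) [IsClosed (G : Set X)]
    [FiniteDimensional ℝ G] (hG : Module.finrank ℝ G = 2) :
    Nonempty (X ≃L[ℝ] (X ⧸ G) × ℝ × ℝ) := by
  obtain ⟨P, hP⟩ := Submodule.ClosedComplemented.of_finiteDimensional G
  have e : G ≃L[ℝ] ℝ × ℝ := ContinuousLinearEquiv.ofFinrankEq (by simp [hG])
  refine ⟨ContinuousLinearEquiv.ofBijective (G.mkQL.prod ((e : G →L[ℝ] ℝ × ℝ).comp P)) ?_ ?_⟩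
  · refine LinearMap.ker_eq_bot'.2 fun x hx => ?_
    have h1 : G.mkQ x = 0 := congrArg Prod.fst hx
    have h2 : e (P x) = 0 := congrArg Prod.snd hx
    have h3 : x ∈ G := by simpa using h1
    have h4 : P x = 0 := by simpa using h2
    rw [hP ⟨x, h3⟩] at h4
    exact congrArg Subtype.val h4
  · refine LinearMap.range_eq_top.2 ?_
    rintro ⟨q, v⟩
    obtain ⟨x, rfl⟩ := G.mkQ_surjective q
    refine ⟨x + (e.symm v - P x : G), Prod.ext ?_ ?_⟩
    · change G.mkQ _ = G.mkQ x
      rw [map_add, add_eq_left, Submodule.mkQ_apply, Submodule.Quotient.mk_eq_zero]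
      exact Subtype.property _
    · change e (P _) = v
      rw [map_add, hP, add_sub_cancel, ContinuousLinearEquiv.apply_symm_apply]

theorem HasDaugavetHullProperty.exists_isSCD_escapesCuts_inter [CompleteSpace X] [Nontrivial X]
    [TopologicalSpace.SeparableSpace X] (hX : HasDaugavetHullProperty X) :
    ∃ C₁ C₂ : Set X,
      IsSymmetricConvexClosedBounded C₁ ∧ (interior C₁).Nonempty ∧
      IsSymmetricConvexClosedBounded C₂ ∧ (interior C₂).Nonempty ∧
      IsSCD C₁ ∧ IsSCD C₂ ∧ EscapesCuts (C₁ ∩ C₂) := by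
  obtain ⟨G, hGfin, hG⟩ := exists_submodule_finrank_eq_two hX.not_finiteDimensional
  have hGc : IsClosed (G : Set X) := G.closed_of_finiteDimensional
  obtain ⟨e⟩ := exists_equiv_quotient_prod G hG
  have : TopologicalSpace.SeparableSpace (X ⧸ G) :=
    G.mkQ_surjective.denseRange.separableSpace G.mkQL.continuous
  have : Nontrivial (X ⧸ G) := by
    refine Submodule.Quotient.nontrivial_iff.2 ?_
    rintro rfl
    exact hX.not_finiteDimensional (Module.finite_def.2 (Module.Finite.iff_fg.1 hGfin))
  have hesc : EscapesCuts (unitBox (X ⧸ G)) := by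
    refine hX.escapesCuts_unitBox G.mkQL (fun x => Submodule.Quotient.norm_mk_le G x)
      (fun q r hr => ?_) ?_
    · obtain ⟨x, hx, hxr⟩ := Submodule.Quotient.norm_mk_lt q (sub_pos.2 hr)
      exact ⟨x, by linarith, hx⟩
    · have : G.mkQL.ker = G := G.ker_mkQ
      rwa [this]
  obtain ⟨C₁, C₂, h1, i1, h2, i2, s1, s2, hC⟩ := exists_isSCD_inter_eq_unitBox (X ⧸ G)
  set T : ((X ⧸ G) × ℝ × ℝ) →L[ℝ] X := (e.symm : ((X ⧸ G) × ℝ × ℝ) →L[ℝ] X) with hT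
  have hTemb : IsClosedEmbedding T := e.symm.toHomeomorph.isClosedEmbedding
  refine ⟨T '' C₁, T '' C₂, h1.image T hTemb, interior_image_equiv_nonempty _ i1, h2.image T hTemb,
    interior_image_equiv_nonempty _ i2, s1.image T (exists_comp_equiv_eq _),
    s2.image T (exists_comp_equiv_eq _), ?_⟩
  rw [← image_inter hTemb.injective, hC]
  exact hesc.image T hTemb.isInducing

end Final

end DaugavetSCD

theorem mainTheorem8 (Y : Type*) [NormedAddCommGroup Y] [NormedSpace ℝ Y] [CompleteSpace Y]
    [Nontrivial Y] (hY : HasDaugavetProperty Y) :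
    (∃ C₁ C₂ : Set Y,
      IsSymmetricConvexClosedBounded C₁ ∧ IsSymmetricConvexClosedBounded C₂ ∧
      IsSCD C₁ ∧ IsSCD C₂ ∧ ¬ IsSCD (C₁ ∩ C₂)) ∧
    (TopologicalSpace.SeparableSpace Y →
      ∃ C₁ C₂ : Set Y,
        IsSymmetricConvexClosedBounded C₁ ∧ (interior C₁).Nonempty ∧
        IsSymmetricConvexClosedBounded C₂ ∧ (interior C₂).Nonempty ∧
        IsSCD C₁ ∧ IsSCD C₂ ∧ ¬ IsSCD (C₁ ∩ C₂)) := by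
  have hhull := hY.hasDaugavetHullProperty
  refine ⟨?_, fun _ => ?_⟩
  · obtain ⟨M, hMc, hMs, hMn, hM⟩ := hhull.exists_separable_submodule
    have : CompleteSpace M := hMc.completeSpace_coe
    have : TopologicalSpace.SeparableSpace M := hMs.separableSpace
    obtain ⟨C₁, C₂, h1, -, h2, -, s1, s2, hC⟩ := hM.exists_isSCD_escapesCuts_inter
    have hemb : Topology.IsClosedEmbedding M.subtypeL := hMc.isClosedEmbedding_subtypeVal
    -- Hahn–Banach turns slices taken within `M` into slices taken within `Y`.
    have hext : ∀ f : M →L[ℝ] ℝ, ∃ g : Y →L[ℝ] ℝ, g.comp M.subtypeL = f := by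
      intro f
      obtain ⟨g, hg, -⟩ := exists_extension_norm_eq M f
      exact ⟨g, ContinuousLinearMap.ext hg⟩
    refine ⟨M.subtypeL '' C₁, M.subtypeL '' C₂, h1.image _ hemb, h2.image _ hemb,
      s1.image _ hext, s2.image _ hext, ?_⟩
    rw [← Set.image_inter hemb.injective]
    exact (hC.image _ hemb.isInducing).not_isSCD
  · obtain ⟨C₁, C₂, h1, i1, h2, i2, s1, s2, hC⟩ := hhull.exists_isSCD_escapesCuts_inter
    exact ⟨C₁, C₂, h1, i1, h2, i2, s1, s2, hC.not_isSCD⟩
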